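/- Let $\mathcal C$ be a category. A *zigzag* $Z$ in $\mathcal C$ of length $n\ge 0$ is a diagram $$r_0\xrightarrow{f_0}s_0\xleftarrow{b_0}r_1\xrightarrow{f_1}s_1\xleftarrow{b_1}\cdots\xrightarrow{f_{n-1}}s_{n-1}\xleftarrow{b_{n-1}}r_n$$ in $\mathcal C$; the $r_j$ ($0\le j\le n$) are its regular objects and the $s_i$ ($0\le i<n$) its singular objects. Write $[n]=\{0<\dots<n-1\}$. For a monotone map $g:[n]\to[m]$ let $g^{\mathrm T}:[n+1]\to[m+1]$ be the extension of $g$ with $g^{\mathrm T}(n)=m$, and let $g':[m+1]\to[n+1]$ be given by $g'(j)=\min\{i\in[n+1] : g^{\mathrm T}(i)\ge j\}$. A *zigzag map* from $Z$ (of length $n$) to $Z^{*}$ (of length $m$, with data $r^*_j,s^*_k,f^*_k,b^*_k$) consists of a monotone map $g:[n]\to[m]$ and morphisms $g_i:s_i\to s^*_{g(i)}$ for $i\in[n]$, such that $r^*_j=r_{g'(j)}$ for all $j\in[m+1]$ and such that the planar diagram formed by $Z$, $Z^*$, the arrows $g_i$ and these identities commutes. That is, for each $k\in[m]$: if $g^{-1}(k)=\{p,p+1,\dots,q\}$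 is non-empty, then $f^*_k=g_p f_p$, $\;g_i b_i=g_{i+1}f_{i+1}$ for $p\le i<q$, and $b^*_k=g_q b_q$; if $g^{-1}(k)$ is empty, then $f^*_k=b^*_k$. Zigzags and zigzag maps, with the evident composition, form the *zigzag category* $Z_{\mathcal C}$. A functor $F:\mathcal C\to\mathcal D$ induces a functor $Z_F:Z_{\mathcal C}\to Z_{\mathcal D}$ by applying $F$ to all objects and morphisms of a zigzag and of a zigzag map. Let $\widehat{\mathcal C}=[\mathcal C,\mathrm{Set}]^{\mathrm{op}}$ and let $y:\mathcal C\to\widehat{\mathcal C}$, $c\mapsto \mathrm{Hom}_{\mathcal C}(c,-)$, be the dual Yoneda embedding. **Corollary.** If $\mathcal C$ has a terminal object, then the functor $Z_y:Z_{\mathcal C}\to Z_{\widehat{\mathcal C}}$ preserves connected, non-empty colimits: for every connected, non-empty category $\mathcal J$ and every diagram $D:\mathcal J\to Z_{\mathcal C}$, every colimiting cocone of $D$ is sent by $Z_y$ to a colimiting cocone of $Z_y D$. -/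

import Mathlib

open CategoryTheory CategoryTheory.Limits

universe v u v' u' w w'

/-! ## Monotone maps and their reversals -/

/-- Given a monotone map `f : [n] → [m]`, the map `fᵀ : [n+1] → [m+1]` which extends `f` by sending
the new top element to the new top element. -/
def addTop {n m : ℕ} (f : Fin n →o Fin m) (i : Fin (n + 1)) : Fin (m + 1) :=
  Fin.lastCases (motive := fun _ => Fin (m + 1)) (Fin.last m) (fun j => (f j).castSucc) i

@[simp] lemma addTop_last {n m : ℕ} (f : Fin n →o Fin m) :
    addTop f (Fin.last n) = Fin.last m := by
  simp [addTop]

@[simp] lemma addTop_castSucc {n m : ℕ} (f : Fin n →o Fin m) (i : Fin n) :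
    addTop f i.castSucc = (f i).castSucc := by
  simp [addTop]

lemma addTop_mono {n m : ℕ} (f : Fin n →o Fin m) : Monotone (addTop f) := by
  intro i j h
  induction j using Fin.lastCases with
  | last => simpa using Fin.le_last _
  | cast j =>
    induction i using Fin.lastCases with
    | last => exact absurd h (not_le.mpr (Fin.castSucc_lt_last j))
    | cast i => simpa using f.monotone (by simpa using h)

/-- The reversal `f' : [m+1] → [n+1]` of a monotone map `f : [n] → [m]`:
`f' j` is the least `i` in `[n+1]` with `j ≤ fᵀ i`. -/
def reversal {n m : ℕ} (f : Fin n →o Fin m) (j : Fin (m + 1)) : Fin (n + 1) :=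
  (Finset.univ.filter fun i : Fin (n + 1) => j ≤ addTop f i).min'
    ⟨Fin.last n, by simpa using Fin.le_last j⟩

lemma reversal_gc {n m : ℕ} (f : Fin n →o Fin m) : GaloisConnection (reversal f) (addTop f) := by
  intro j i
  constructor
  · intro h
    have h1 := Finset.min'_mem (Finset.univ.filter fun i : Fin (n + 1) => j ≤ addTop f i)
      ⟨Fin.last n, by simpa using Fin.le_last j⟩
    exact (Finset.mem_filter.mp h1).2.trans (addTop_mono f h)
  · intro h
    exact Finset.min'_le _ _ (by simpa using h)

lemma reversal_mono {n m : ℕ} (f : Fin n →o Fin m) : Monotone (reversal f) :=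
  (reversal_gc f).monotone_l

@[simp] lemma reversal_id {n : ℕ} (j : Fin (n + 1)) :
    reversal (OrderHom.id : Fin n →o Fin n) j = j := by
  have h : ∀ i, addTop (OrderHom.id : Fin n →o Fin n) i = i := by
    intro i
    induction i using Fin.lastCases <;> simp
  refine eq_of_forall_ge_iff fun i => ?_
  rw [reversal_gc _ _ _, h]

lemma reversal_comp {n m l : ℕ} (g : Fin m →o Fin l) (f : Fin n →o Fin m) (j : Fin (l + 1)) :
    reversal (g.comp f) j = reversal f (reversal g j) := by
  have h : ∀ i, addTop (g.comp f) i = addTop g (addTop f i) := by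
    intro i
    induction i using Fin.lastCases <;> simp
  refine eq_of_forall_ge_iff fun i => ?_
  rw [reversal_gc _ _ _, reversal_gc _ _ _, reversal_gc _ _ _, h]

lemma reversal_castSucc_le_iff {n m : ℕ} (f : Fin n →o Fin m) (k : Fin m) (i : Fin n) :
    reversal f k.castSucc ≤ i.castSucc ↔ k ≤ f i := by
  rw [reversal_gc _ _ _, addTop_castSucc, Fin.castSucc_le_castSucc_iff]

lemma reversal_succ_le_iff {n m : ℕ} (f : Fin n →o Fin m) (k : Fin m) (i : Fin n) :
    reversal f k.succ ≤ i.castSucc ↔ k < f i := by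
  rw [reversal_gc _ _ _, addTop_castSucc, Fin.succ_le_castSucc_iff]

/-! ## Zigzags and zigzag maps -/

/-- A zigzag `r₀ → s₀ ← r₁ → s₁ ← ⋯ ← rₙ` in a category. -/
structure ZigzagObj (C : Type u) [Category.{v} C] where
  /-- the number of singular heights -/
  len : ℕ
  /-- the regular objects -/
  reg : Fin (len + 1) → C
  /-- the singular objects -/
  sing : Fin len → C
  /-- the forward morphisms -/
  fwd : ∀ i : Fin len, reg i.castSucc ⟶ sing i
  /-- the backward morphisms -/
  bwd : ∀ i : Fin len, reg i.succ ⟶ sing i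

namespace ZigzagObj

variable {C : Type u} [Category.{v} C]

/-- A zigzag map `Z ⟶ Z'`. The faces of the planar diagram made of `Z`, `Z'`, the arrows
`app i : sᵢ ⟶ s'_{f i}` and the identities between `r'ⱼ` and `r_{f' j}` are the
following, where `k` is a height of `Z'`: the square bounded by the identity at `r'ₖ` and the first
arrow into `s'ₖ`, the squares between two consecutive arrows into `s'ₖ`, the square bounded by the
last arrow into `s'ₖ` and the identity at `r'ₖ₊₁`, and, if there are no arrows into `s'ₖ` at all,
the face bounded by the two identities. -/
structure Hom (Z Z' : ZigzagObj C) where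
  /-- the monotone map on singular heights -/
  singMap : Fin Z.len →o Fin Z'.len
  /-- the morphisms on singular objects -/
  app : ∀ i : Fin Z.len, Z.sing i ⟶ Z'.sing (singMap i)
  /-- the equalities between regular objects -/
  reg_eq : ∀ j : Fin (Z'.len + 1), Z'.reg j = Z.reg (reversal singMap j)
  /-- the face at the first arrow into a singular object -/
  comm_first : ∀ (i : Fin Z.len) (h : reversal singMap (singMap i).castSucc = i.castSucc),
    Z'.fwd (singMap i) =
      eqToHom ((reg_eq _).trans (congrArg Z.reg h)) ≫ Z.fwd i ≫ app i
  /-- the face at the last arrow into a singular object -/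
  comm_last : ∀ (i : Fin Z.len) (h : reversal singMap (singMap i).succ = i.succ),
    Z'.bwd (singMap i) =
      eqToHom ((reg_eq _).trans (congrArg Z.reg h)) ≫ Z.bwd i ≫ app i
  /-- the face between consecutive arrows into a singular object -/
  comm_mid : ∀ (i j : Fin Z.len) (h : i.succ = j.castSucc) (hk : singMap i = singMap j),
    Z.bwd i ≫ app i ≫ eqToHom (congrArg Z'.sing hk) =
      eqToHom (congrArg Z.reg h) ≫ Z.fwd j ≫ app j
  /-- the face at a singular object that receives no arrow -/
  comm_empty : ∀ (k : Fin Z'.len) (h : reversal singMap k.castSucc = reversal singMap k.succ),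
    Z'.fwd k =
      eqToHom ((reg_eq _).trans ((congrArg Z.reg h).trans (reg_eq _).symm)) ≫ Z'.bwd k

namespace Hom

lemma ext' {Z Z' : ZigzagObj C} {f g : Hom Z Z'} (h : ∀ i, f.singMap i = g.singMap i)
    (happ : ∀ i, f.app i ≫ eqToHom (congrArg Z'.sing (h i)) = g.app i) : f = g := by
  obtain ⟨f1, f2, _, _, _, _, _⟩ := f
  obtain ⟨g1, g2, _, _, _, _, _⟩ := g
  obtain rfl : f1 = g1 := OrderHom.ext _ _ (funext h)
  obtain rfl : f2 = g2 := funext fun i => by simpa using happ i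
  rfl

/-- The identity zigzag map. -/
def id (Z : ZigzagObj C) : Hom Z Z where
  singMap := OrderHom.id
  app i := 𝟙 _
  reg_eq j := by simp
  comm_first i h := by
    have fin : Z.fwd i = eqToHom rfl ≫ Z.fwd i ≫ 𝟙 (Z.sing i) := by simp
    exact fin
  comm_last i h := by
    have fin : Z.bwd i = eqToHom rfl ≫ Z.bwd i ≫ 𝟙 (Z.sing i) := by simp
    exact fin
  comm_mid i j h hk := by
    obtain rfl : i = j := hk
    exact absurd h (by simp [Fin.ext_iff])
  comm_empty k h := by
    rw [reversal_id, reversal_id] at h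
    exact absurd h (by simp [Fin.ext_iff])

variable {Z Z' Z'' : ZigzagObj C}

lemma reversal_singMap_le (f : Hom Z Z') (i : Fin Z.len) :
    reversal f.singMap (f.singMap i).castSucc ≤ i.castSucc :=
  (reversal_castSucc_le_iff _ _ _).mpr le_rfl

lemma le_reversal_singMap (f : Hom Z Z') (i : Fin Z.len) :
    i.succ ≤ reversal f.singMap (f.singMap i).succ := by
  rw [← Fin.castSucc_lt_iff_succ_le, ← not_le, reversal_succ_le_iff]
  exact lt_irrefl _

/-- A map out of the regular object at height `p` that is compatible with a target height `k`:
it is either the composite of a forward morphism with `app`, or a backward morphism. -/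
lemma exists_cocone (g : Hom Z' Z'') (k : Fin Z''.len) :
    ∃ σ : ∀ p : Fin (Z'.len + 1), reversal g.singMap k.castSucc ≤ p →
        p ≤ reversal g.singMap k.succ → (Z'.reg p ⟶ Z''.sing k),
      (∀ (p) (h1) (h2) (h : reversal g.singMap k.castSucc = p),
        Z''.fwd k = eqToHom ((g.reg_eq _).trans (congrArg Z'.reg h)) ≫ σ p h1 h2) ∧
      (∀ (p) (h1) (h2) (h : reversal g.singMap k.succ = p),
        Z''.bwd k = eqToHom ((g.reg_eq _).trans (congrArg Z'.reg h)) ≫ σ p h1 h2) ∧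
      (∀ (l : Fin Z'.len) (hl : g.singMap l = k) (h1) (h2),
        σ l.castSucc h1 h2 = Z'.fwd l ≫ g.app l ≫ eqToHom (congrArg Z''.sing hl)) ∧
      (∀ (l : Fin Z'.len) (hl : g.singMap l = k) (h1) (h2),
        σ l.succ h1 h2 = Z'.bwd l ≫ g.app l ≫ eqToHom (congrArg Z''.sing hl)) := by
  classical
  have key : ∀ p : Fin (Z'.len + 1), reversal g.singMap k.castSucc ≤ p →
      p ≤ reversal g.singMap k.succ → ∃ s : Z'.reg p ⟶ Z''.sing k,
      (∀ (h : reversal g.singMap k.castSucc = p),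
        Z''.fwd k = eqToHom ((g.reg_eq _).trans (congrArg Z'.reg h)) ≫ s) ∧
      (∀ (h : reversal g.singMap k.succ = p),
        Z''.bwd k = eqToHom ((g.reg_eq _).trans (congrArg Z'.reg h)) ≫ s) ∧
      (∀ (l : Fin Z'.len) (hl : g.singMap l = k) (hp : p = l.castSucc),
        s = eqToHom (congrArg Z'.reg hp) ≫ Z'.fwd l ≫ g.app l ≫
          eqToHom (congrArg Z''.sing hl)) ∧
      (∀ (l : Fin Z'.len) (hl : g.singMap l = k) (hp : p = l.succ),
        s = eqToHom (congrArg Z'.reg hp) ≫ Z'.bwd l ≫ g.app l ≫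
          eqToHom (congrArg Z''.sing hl)) := by
    intro p h1 h2
    rcases h2.lt_or_eq with hlt | heq
    · obtain ⟨i, rfl⟩ : ∃ i : Fin Z'.len, i.castSucc = p :=
        ⟨p.castPred (ne_of_lt (lt_of_lt_of_le hlt (Fin.le_last _))), by simp⟩
      have hik : g.singMap i = k := by
        refine le_antisymm ?_ ((reversal_castSucc_le_iff _ _ _).mp h1)
        rw [← not_lt, ← reversal_succ_le_iff]
        exact not_le.mpr hlt
      subst hik
      refine ⟨Z'.fwd i ≫ g.app i, fun h => g.comm_first i h, fun h => absurd h hlt.ne', ?_, ?_⟩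
      · intro l hl hp
        obtain rfl := Fin.castSucc_injective _ hp
        simp
      · intro l hl hp
        have := g.comm_mid l i hp.symm hl
        rw [this]
        simp
    · subst heq
      refine ⟨eqToHom (g.reg_eq _).symm ≫ Z''.bwd k, ?_, ?_, ?_, ?_⟩
      · intro h
        rw [g.comm_empty k h]
        simp
      · intro h
        simp
      · intro l hl hp
        exact absurd ((reversal_succ_le_iff _ _ _).mp hp.le) (by simp [hl])
      · intro l hl hp
        subst hl
        rw [g.comm_last l hp]
        simp
  choose σ h1 h2 h3 h4 using key
  refine ⟨σ, fun p a b h => h1 p a b h, fun p a b h => h2 p a b h, fun l hl a b => ?_,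
    fun l hl a b => ?_⟩
  · simpa using h3 _ a b l hl rfl
  · simpa using h4 _ a b l hl rfl

lemma cocone_const (f : Hom Z Z') (g : Hom Z' Z'') (k : Fin Z''.len)
    (σ : ∀ p : Fin (Z'.len + 1), reversal g.singMap k.castSucc ≤ p →
        p ≤ reversal g.singMap k.succ → (Z'.reg p ⟶ Z''.sing k))
    (h3 : ∀ (l : Fin Z'.len) (hl : g.singMap l = k) (h1) (h2),
        σ l.castSucc h1 h2 = Z'.fwd l ≫ g.app l ≫ eqToHom (congrArg Z''.sing hl))
    (h4 : ∀ (l : Fin Z'.len) (hl : g.singMap l = k) (h1) (h2),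
        σ l.succ h1 h2 = Z'.bwd l ≫ g.app l ≫ eqToHom (congrArg Z''.sing hl))
    (p : Fin (Z'.len + 1)) (hp1 : reversal g.singMap k.castSucc ≤ p)
    (hp2 : p ≤ reversal g.singMap k.succ) (q : Fin (Z'.len + 1)) :
    ∀ (hq1 : reversal g.singMap k.castSucc ≤ q) (hq2 : q ≤ reversal g.singMap k.succ)
    (_ : p ≤ q) (h : reversal f.singMap p = reversal f.singMap q),
    σ p hp1 hp2 = eqToHom ((f.reg_eq p).trans ((congrArg Z.reg h).trans (f.reg_eq q).symm)) ≫
      σ q hq1 hq2 := by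
  induction q using Fin.induction with
  | zero =>
    intro hq1 hq2 hpq h
    obtain rfl := Fin.le_zero_iff.mp hpq
    simp
  | succ l ih =>
    intro hq1 hq2 hpq h
    rcases hpq.lt_or_eq with hlt | rfl
    · have hpl : p ≤ l.castSucc := Fin.le_castSucc_iff.mpr hlt
      have hl : l.castSucc ≤ l.succ := (Fin.castSucc_lt_succ).le
      have e1 : reversal f.singMap p = reversal f.singMap l.castSucc :=
        le_antisymm (reversal_mono _ hpl) (h ▸ reversal_mono _ hl)
      have e2 : reversal f.singMap l.castSucc = reversal f.singMap l.succ := e1.symm.trans h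
      have hlk : g.singMap l = k := by
        refine le_antisymm ?_ ((reversal_castSucc_le_iff _ _ _).mp (hp1.trans hpl))
        rw [← not_lt, ← reversal_succ_le_iff, not_le]
        exact lt_of_lt_of_le (Fin.castSucc_lt_succ) hq2
      rw [ih (hp1.trans hpl) (hl.trans hq2) hpl e1, h3 l hlk, h4 l hlk, f.comm_empty l e2]
      simp
    · simp

/-- Composition of zigzag maps. -/
def comp (f : Hom Z Z') (g : Hom Z' Z'') : Hom Z Z'' where
  singMap := g.singMap.comp f.singMap
  app i := f.app i ≫ g.app (f.singMap i)
  reg_eq j := by rw [reversal_comp, g.reg_eq, f.reg_eq]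
  comm_first i h := by
    have h' : reversal f.singMap
        (reversal g.singMap (g.singMap (f.singMap i)).castSucc) = i.castSucc := by
      rw [← reversal_comp]; exact h
    obtain ⟨σ, h1, h2, h3, h4⟩ := g.exists_cocone (g.singMap (f.singMap i))
    have hp := g.reversal_singMap_le (f.singMap i)
    have hp2 := (Fin.castSucc_lt_succ).le.trans (g.le_reversal_singMap (f.singMap i))
    have e : reversal f.singMap (f.singMap i).castSucc = i.castSucc :=
      le_antisymm (f.reversal_singMap_le i) (h' ▸ reversal_mono _ hp)
    have := cocone_const f g _ σ h3 h4 _ le_rfl (hp.trans hp2) _ hp hp2 hp (h'.trans e.symm)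
    have fin : Z''.fwd (g.singMap (f.singMap i)) =
        eqToHom ((g.reg_eq _).trans ((f.reg_eq _).trans (congrArg Z.reg h'))) ≫
          Z.fwd i ≫ f.app i ≫ g.app (f.singMap i) := by
      rw [h1 _ le_rfl (hp.trans hp2) rfl, this, h3 _ rfl, f.comm_first i e]
      simp
    exact fin
  comm_last i h := by
    have h' : reversal f.singMap
        (reversal g.singMap (g.singMap (f.singMap i)).succ) = i.succ := by
      rw [← reversal_comp]; exact h
    obtain ⟨σ, h1, h2, h3, h4⟩ := g.exists_cocone (g.singMap (f.singMap i))
    have hp := g.le_reversal_singMap (f.singMap i)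
    have hp2 := (g.reversal_singMap_le (f.singMap i)).trans (Fin.castSucc_lt_succ).le
    have e : reversal f.singMap (f.singMap i).succ = i.succ :=
      le_antisymm (h' ▸ reversal_mono _ hp) (f.le_reversal_singMap i)
    have := cocone_const f g _ σ h3 h4 _ hp2 hp _ (hp2.trans hp) le_rfl hp (e.trans h'.symm)
    rw [h4 _ rfl, f.comm_last i e] at this
    have fin : Z''.bwd (g.singMap (f.singMap i)) =
        eqToHom ((g.reg_eq _).trans ((f.reg_eq _).trans (congrArg Z.reg h'))) ≫
          Z.bwd i ≫ f.app i ≫ g.app (f.singMap i) := by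
      have E : Z'.reg (f.singMap i).succ =
          Z'.reg (reversal g.singMap (g.singMap (f.singMap i)).succ) := by
        rw [f.reg_eq, f.reg_eq, e, h']
      rw [h2 _ (hp2.trans hp) le_rfl rfl, ← cancel_epi (eqToHom (E.trans (g.reg_eq _).symm))]
      simpa using this.symm
    exact fin
  comm_mid i j h hk := by
    have hk' : g.singMap (f.singMap i) = g.singMap (f.singMap j) := hk
    by_cases hf : f.singMap i = f.singMap j
    · have := f.comm_mid i j h hf
      have e : g.app (f.singMap i) ≫ eqToHom (congrArg Z''.sing hk') =
          eqToHom (congrArg Z'.sing hf) ≫ g.app (f.singMap j) := by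
        clear this
        generalize f.singMap j = b at hf hk'
        subst hf
        simp
      have fin : Z.bwd i ≫ (f.app i ≫ g.app (f.singMap i)) ≫ eqToHom (congrArg Z''.sing hk') =
          eqToHom (congrArg Z.reg h) ≫ Z.fwd j ≫ f.app j ≫ g.app (f.singMap j) := by
        rw [Category.assoc, e, reassoc_of% this]
      exact fin
    · have hlt : f.singMap i < f.singMap j :=
        lt_of_le_of_ne (f.singMap.monotone (by
          have := congrArg Fin.val h
          simp only [Fin.val_succ, Fin.val_castSucc] at this
          exact Fin.le_def.mpr (by omega))) hf
      have hpq : (f.singMap i).succ ≤ (f.singMap j).castSucc := Fin.succ_le_castSucc_iff.mpr hlt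
      have e0 := (reversal_mono f.singMap hpq).trans (f.reversal_singMap_le j)
      have e1 : reversal f.singMap (f.singMap i).succ = i.succ :=
        le_antisymm (h ▸ e0) (f.le_reversal_singMap i)
      have e2 : reversal f.singMap (f.singMap j).castSucc = j.castSucc :=
        le_antisymm (f.reversal_singMap_le j)
          (h ▸ (f.le_reversal_singMap i).trans (reversal_mono _ hpq))
      obtain ⟨σ, h1, h2, h3, h4⟩ := g.exists_cocone (g.singMap (f.singMap j))
      have b1 : reversal g.singMap (g.singMap (f.singMap j)).castSucc ≤ (f.singMap i).succ := by
        rw [← hk']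
        exact (g.reversal_singMap_le _).trans (Fin.castSucc_lt_succ).le
      have b2 : (f.singMap j).castSucc ≤ reversal g.singMap (g.singMap (f.singMap j)).succ :=
        (Fin.castSucc_lt_succ).le.trans (g.le_reversal_singMap _)
      have := cocone_const f g _ σ h3 h4 _ b1 (hpq.trans b2) _ (b1.trans hpq) b2 hpq
        (e1.trans (h.trans e2.symm))
      rw [h3 _ rfl, h4 _ hk', f.comm_first j e2, f.comm_last i e1] at this
      have fin : Z.bwd i ≫ (f.app i ≫ g.app (f.singMap i)) ≫ eqToHom (congrArg Z''.sing hk') =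
          eqToHom (congrArg Z.reg h) ≫ Z.fwd j ≫ f.app j ≫ g.app (f.singMap j) := by
        rw [← cancel_epi (eqToHom ((f.reg_eq _).trans (congrArg Z.reg e1)))]
        simpa using this
      exact fin
  comm_empty k h := by
    have h' : reversal f.singMap (reversal g.singMap k.castSucc) =
        reversal f.singMap (reversal g.singMap k.succ) := by
      rw [← reversal_comp, ← reversal_comp]; exact h
    obtain ⟨σ, h1, h2, h3, h4⟩ := g.exists_cocone k
    have hle := reversal_mono g.singMap (Fin.castSucc_lt_succ (i := k)).le
    have := cocone_const f g _ σ h3 h4 _ le_rfl hle _ hle le_rfl hle h'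
    rw [h1 _ le_rfl hle rfl, h2 _ hle le_rfl rfl, this]
    simp

end Hom

/-- The zigzag category of `C`. -/
instance : Category (ZigzagObj C) where
  Hom := Hom
  id := Hom.id
  comp := Hom.comp
  id_comp {X Y} f := Hom.ext' (fun _ => rfl) (fun i => by
    change (𝟙 (X.sing i) ≫ f.app i) ≫ 𝟙 (Y.sing (f.singMap i)) = f.app i
    simp)
  comp_id {X Y} f := Hom.ext' (fun _ => rfl) (fun i => by
    change (f.app i ≫ 𝟙 (Y.sing (f.singMap i))) ≫ 𝟙 (Y.sing (f.singMap i)) = f.app i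
    simp)
  assoc {W X Y Z} f g h := Hom.ext' (fun _ => rfl) (fun i => by
    change ((f.app i ≫ g.app (f.singMap i)) ≫ h.app (g.singMap (f.singMap i))) ≫
      𝟙 (Z.sing (h.singMap (g.singMap (f.singMap i)))) =
        f.app i ≫ g.app (f.singMap i) ≫ h.app (g.singMap (f.singMap i))
    simp)

end ZigzagObj

namespace ZigzagObj

variable {C : Type u} [Category.{v} C] {D : Type u'} [Category.{v'} D] (F : C ⥤ D)

/-- The image of a zigzag under a functor. -/
@[simps]
def mapObj (Z : ZigzagObj C) : ZigzagObj D where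
  len := Z.len
  reg j := F.obj (Z.reg j)
  sing i := F.obj (Z.sing i)
  fwd i := F.map (Z.fwd i)
  bwd i := F.map (Z.bwd i)

/-- The image of a zigzag map under a functor. -/
def Hom.mapHom {Z Z' : ZigzagObj C} (f : Hom Z Z') : Hom (mapObj F Z) (mapObj F Z') where
  singMap := f.singMap
  app i := F.map (f.app i)
  reg_eq j := congrArg F.obj (f.reg_eq j)
  comm_first i h := by
    have := congrArg F.map (f.comm_first i h)
    rw [F.map_comp, F.map_comp, eqToHom_map] at this
    exact this
  comm_last i h := by
    have := congrArg F.map (f.comm_last i h)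
    rw [F.map_comp, F.map_comp, eqToHom_map] at this
    exact this
  comm_mid i j h hk := by
    have := congrArg F.map (f.comm_mid i j h hk)
    rw [F.map_comp, F.map_comp, F.map_comp, F.map_comp, eqToHom_map, eqToHom_map] at this
    exact this
  comm_empty k h := by
    have := congrArg F.map (f.comm_empty k h)
    rw [F.map_comp, eqToHom_map] at this
    exact this

end ZigzagObj

/-- The zigzag functor induced by a functor `F : C ⥤ D`, which applies `F` to all
objects and morphisms of a zigzag and of a zigzag map. -/
def zigzagFunctor {C : Type u} [Category.{v} C] {D : Type u'} [Category.{v'} D] (F : C ⥤ D) :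
    ZigzagObj C ⥤ ZigzagObj D where
  obj Z := ZigzagObj.mapObj F Z
  map f := ZigzagObj.Hom.mapHom F f
  map_id Z := ZigzagObj.Hom.ext' (fun _ => rfl) (fun i => by
    change F.map (𝟙 (Z.sing i)) ≫ 𝟙 (F.obj (Z.sing i)) = 𝟙 (F.obj (Z.sing i))
    simp)
  map_comp {X Y Z} f g := ZigzagObj.Hom.ext' (fun _ => rfl) (fun i => by
    change F.map (f.app i ≫ g.app (f.singMap i)) ≫
      𝟙 (F.obj (Z.sing (g.singMap (f.singMap i)))) =
        F.map (f.app i) ≫ F.map (g.app (f.singMap i))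
    simp)

/-- The dual Yoneda embedding `C ⥤ [C, Set]ᵒᵖ`, `c ↦ Hom(c, -)`. -/
abbrev dualYoneda (C : Type u) [Category.{v} C] : C ⥤ (C ⥤ Type v)ᵒᵖ :=
  coyoneda.rightOp

/-!
The embedding `y : C ⥤ [C, Set]ᵒᵖ` is fully faithful, and every object of `[C, Set]ᵒᵖ` is the limit of
the representables it maps to: a map `y c ⟶ B` is the same as a natural choice of maps `c ⟶ x`, one for
each `q : B ⟶ y x`. The theorem is proved for any functor `F : C ⥤ D` with these two properties
(`IsWeaklyCodense`).

Let `c` be a colimit cocone of `K : J ⥤ ZigzagObj C`, and let a cocone on its image with vertex `W` be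
given, with legs `w j`. The regular objects of `W` are images of regular objects of the `K j`, and
since `J` is connected, they are the images of objects `r k` of `C` which do not depend on `j`. The
singular objects of `W` need not be images of objects of `C`, but they may be tested against such
objects. A `Probe` picks, at some of the heights of `W`, a map from the singular object to an object
`F x`. It gives rise to a zigzag in `C` (`Probe.zigzag`) with the same length as `W` and with regular
objects `r`, whose singular objects are the objects picked by the probe, and the terminal object of
`C` at all other heights. The terminal object is what makes it possible to test a single height at a
time, and, with the probe that picks nothing, to recover the monotone map on heights.

A zigzag map from the image of `X` to `W` induces a map from `X` to the zigzag of each probe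
(`Probe.descend`). Conversely, a family of maps from `X` to the zigzags of all probes which is natural
in the probe comes from a unique zigzag map from the image of `X` to `W` (`hom_ext_descend`,
`exists_descend_eq`). So the legs `w j` give a cocone on `K` with vertex the zigzag of any probe, the
colimit property of `c` gives maps from the vertex of `c`, natural in the probe, and these assemble to
the map out of the image of the vertex of `c` that is sought.
-/

namespace ZigzagObj

variable {C : Type u} [Category.{v} C] {D : Type u'} [Category.{v'} D] {F : C ⥤ D}

/-! ### Zigzag maps out of the image of a zigzag -/

section mapObj

variable {X : ZigzagObj C} {W : ZigzagObj D} (w : Hom (mapObj F X) W)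

/-- The monotone map on heights of a zigzag map out of `mapObj F X`. This is `w.singMap`, with its type
expressed through `X` instead of `mapObj F X`, as is the case for the lemmas below. -/
def Hom.heights : Fin X.len →o Fin W.len := w.singMap

/-- The morphisms on singular objects of a zigzag map out of `mapObj F X`. -/
def Hom.component (i : Fin X.len) : F.obj (X.sing i) ⟶ W.sing (w.heights i) := w.app i

lemma Hom.reg_eq_obj (j : Fin (W.len + 1)) : W.reg j = F.obj (X.reg (reversal w.heights j)) :=
  w.reg_eq j

lemma Hom.fwd_heights (i : Fin X.len)
    (h : reversal w.heights (w.heights i).castSucc = i.castSucc) :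
    W.fwd (w.heights i) =
      eqToHom ((w.reg_eq_obj _).trans (congrArg (fun p => F.obj (X.reg p)) h)) ≫
        F.map (X.fwd i) ≫ w.component i :=
  w.comm_first i h

lemma Hom.bwd_heights (i : Fin X.len)
    (h : reversal w.heights (w.heights i).succ = i.succ) :
    W.bwd (w.heights i) =
      eqToHom ((w.reg_eq_obj _).trans (congrArg (fun p => F.obj (X.reg p)) h)) ≫
        F.map (X.bwd i) ≫ w.component i :=
  w.comm_last i h

lemma Hom.bwd_component (i j : Fin X.len) (h : i.succ = j.castSucc)
    (hk : w.heights i = w.heights j) :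
    F.map (X.bwd i) ≫ w.component i ≫ eqToHom (congrArg W.sing hk) =
      eqToHom (congrArg (fun p => F.obj (X.reg p)) h) ≫ F.map (X.fwd j) ≫ w.component j :=
  w.comm_mid i j h hk

lemma Hom.fwd_eq_bwd (k : Fin W.len)
    (h : reversal w.heights k.castSucc = reversal w.heights k.succ) :
    W.fwd k = eqToHom ((w.reg_eq_obj _).trans
      ((congrArg (fun p => F.obj (X.reg p)) h).trans (w.reg_eq_obj _).symm)) ≫ W.bwd k :=
  w.comm_empty k h

end mapObj

/-! ### Probes -/

/-- A probe of a zigzag `W` in `D` picks, at some of the heights `k` of `W` (the active ones), a map from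
the singular object of `W` to the image of an object of `C`. The object `obj k` is irrelevant at the
other heights. -/
structure Probe (F : C ⥤ D) (W : ZigzagObj D) where
  /-- the heights at which a map is picked -/
  active : Fin W.len → Prop
  /-- the objects of `C` whose images are the targets of the maps -/
  obj : Fin W.len → C
  /-- the maps -/
  map : ∀ k, active k → (W.sing k ⟶ F.obj (obj k))

namespace Probe

variable {W : ZigzagObj D} (P : Probe F W)

lemma eqToHom_comp_map {k l : Fin W.len} (e : k = l) (h : P.active l) :
    eqToHom (congrArg W.sing e) ≫ P.map l h =
      P.map k (e ▸ h) ≫ eqToHom (congrArg (fun k => F.obj (P.obj k)) e) := by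
  subst e
  simp

/-- A refinement of a probe `P` to a probe `P'` exhibits all maps picked by `P'` as composites of maps
picked by `P` with maps of `C`. -/
structure Refines (P P' : Probe F W) where
  /-- the active heights of `P'` are active for `P` -/
  active : ∀ k, P'.active k → P.active k
  /-- the maps of `C` -/
  hom : ∀ k, P'.active k → (P.obj k ⟶ P'.obj k)
  /-- the maps picked by `P'` are the composites -/
  map_hom : ∀ k (h : P'.active k), P.map k (active k h) ≫ F.map (hom k h) = P'.map k h

/-- The probe which picks the map `q` at the height `k` and nothing elsewhere. -/
@[reducible]
def single (k : Fin W.len) {x : C} (q : W.sing k ⟶ F.obj x) : Probe F W where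
  active l := l = k
  obj _ := x
  map _ h := eqToHom (congrArg W.sing h) ≫ q

lemma single_active {k : Fin W.len} {x : C} (q : W.sing k ⟶ F.obj x) : (single k q).active k :=
  rfl

lemma single_map_self {k : Fin W.len} {x : C} (q : W.sing k ⟶ F.obj x) :
    (single k q).map k (single_active q) = q :=
  Category.id_comp q

/-- A probe `P` refines to the probe which picks the composite of the map of `P` at the height `k` with
`F.map f`, and nothing at other heights. -/
def refinesSingle (k : Fin W.len) (hk : P.active k) {x : C} (f : P.obj k ⟶ x) :
    Refines P (single k (P.map k hk ≫ F.map f)) where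
  active l h := h ▸ hk
  hom l h := eqToHom (congrArg P.obj h) ≫ f
  map_hom l h := by
    have hl : l = k := h
    subst hl
    simp [single]

variable [HasTerminal C]

/-- The probe which picks nothing. -/
noncomputable def none : Probe F W where
  active _ := False
  obj _ := ⊤_ C
  map _ h := h.elim

/-- Every probe refines to the one which picks nothing. -/
def refinesNone : Refines P none where
  active _ h := h.elim
  hom _ h := h.elim
  map_hom _ h := h.elim

/-! ### The zigzag of a probe -/

open Classical in
/-- The singular objects of the zigzag of a probe. The object at the height `k` has the universal
property of a product of copies of `P.obj k` indexed by the proofs that `k` is active, with projections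
`proj`, tupling `lift` and extensionality principle `hom_ext`. -/
noncomputable def sing (k : Fin W.len) : C :=
  if P.active k then P.obj k else ⊤_ C

lemma sing_eq_obj {k : Fin W.len} (h : P.active k) : P.sing k = P.obj k :=
  if_pos h

lemma sing_eq_terminal {k : Fin W.len} (h : ¬ P.active k) : P.sing k = ⊤_ C :=
  if_neg h

/-- The identification of `P.sing k` with `P.obj k` at an active height. -/
noncomputable def proj {k : Fin W.len} (h : P.active k) : P.sing k ⟶ P.obj k :=
  eqToHom (P.sing_eq_obj h)

open Classical in
/-- The map into `P.sing k` determined by its composite with `P.proj`. -/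
noncomputable def lift {X : C} {k : Fin W.len} (f : P.active k → (X ⟶ P.obj k)) :
    X ⟶ P.sing k :=
  if h : P.active k then f h ≫ eqToHom (P.sing_eq_obj h).symm
  else terminal.from X ≫ eqToHom (P.sing_eq_terminal h).symm

@[simp]
lemma lift_proj {X : C} {k : Fin W.len} (f : P.active k → (X ⟶ P.obj k)) (h : P.active k) :
    P.lift f ≫ P.proj h = f h := by
  simp [lift, proj, h]

@[simp]
lemma map_lift_proj {X : C} {k : Fin W.len} (f : P.active k → (X ⟶ P.obj k)) (h : P.active k) :
    F.map (P.lift f) ≫ F.map (P.proj h) = F.map (f h) := by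
  rw [← F.map_comp, lift_proj]

lemma map_lift_proj_assoc {X : C} {k : Fin W.len} (f : P.active k → (X ⟶ P.obj k))
    (h : P.active k) {Y : D} (g : F.obj (P.obj k) ⟶ Y) :
    F.map (P.lift f) ≫ F.map (P.proj h) ≫ g = F.map (f h) ≫ g := by
  rw [← Category.assoc, map_lift_proj]

lemma hom_ext {X : C} {k : Fin W.len} {f g : X ⟶ P.sing k}
    (h : ∀ hk : P.active k, f ≫ P.proj hk = g ≫ P.proj hk) : f = g := by
  by_cases hk : P.active k
  · rw [← cancel_mono (eqToHom (P.sing_eq_obj hk))]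
    exact h hk
  · rw [← cancel_mono (eqToHom (P.sing_eq_terminal hk))]
    exact Subsingleton.elim _ _

lemma eqToHom_proj {k l : Fin W.len} (e : k = l) (h : P.active l) :
    eqToHom (congrArg P.sing e) ≫ P.proj h = P.proj (e ▸ h) ≫ eqToHom (congrArg P.obj e) := by
  subst e
  simp

variable [F.Full] {r : Fin (W.len + 1) → C} (hr : ∀ j, W.reg j = F.obj (r j))

/-- The zigzag in `C` determined by a probe of `W`, when the regular objects of `W` are the images of
objects `r j` of `C`. Its forward and backward morphisms are the composites of those of `W` with the
maps picked by the probe. It is reducible so that its heights are recognized as those of `W`. -/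
@[reducible]
noncomputable def zigzag : ZigzagObj C where
  len := W.len
  reg := r
  sing := P.sing
  fwd k := P.lift fun h => F.preimage (eqToHom (hr _).symm ≫ W.fwd k ≫ P.map k h)
  bwd k := P.lift fun h => F.preimage (eqToHom (hr _).symm ≫ W.bwd k ≫ P.map k h)

/-! ### Maps into the zigzag of a probe -/

section toObj

variable {P} {hr} {X : ZigzagObj C} (d : Hom X (P.zigzag hr)) {a : Fin X.len →o Fin W.len}

/-- The part of a zigzag map `d` from `X` to the zigzag of `P` that lies over an active height. The
monotone map `a` on heights is allowed to differ from that of `d` by a propositional equality, so that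
the maps to the zigzags of different probes can be compared. -/
noncomputable def toObj (hs : d.singMap = a) (i : Fin X.len) (h : P.active (a i)) :
    X.sing i ⟶ P.obj (a i) :=
  d.app i ≫ eqToHom (congrArg P.sing (DFunLike.congr_fun hs i)) ≫ P.proj h

lemma toObj_rfl (i : Fin X.len) (h : P.active (d.singMap i)) :
    toObj d rfl i h = d.app i ≫ P.proj h := by
  simp [toObj]

/-- A zigzag map to the zigzag of `P` makes the first face over an active height of `W` commute after
composition with the map picked by `P`. The next three lemmas are the analogues for the other faces. -/
lemma fwd_map (hs : d.singMap = a) (hW : ∀ j, W.reg j = F.obj (X.reg (reversal a j)))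
    (i : Fin X.len) (hi : P.active (a i)) (h : reversal a (a i).castSucc = i.castSucc) :
    W.fwd (a i) ≫ P.map (a i) hi =
      eqToHom ((hW _).trans (congrArg (fun p => F.obj (X.reg p)) h)) ≫
        F.map (X.fwd i) ≫ F.map (toObj d hs i hi) := by
  subst hs
  have := congrArg F.map (d.comm_first i h =≫ P.proj hi)
  rw [lift_proj, F.map_preimage, Category.assoc, Category.assoc, F.map_comp,
    CategoryTheory.eqToHom_map, F.map_comp, ← toObj_rfl] at this
  rw [← cancel_epi (eqToHom (hr _).symm)]
  simpa using this

lemma bwd_map (hs : d.singMap = a) (hW : ∀ j, W.reg j = F.obj (X.reg (reversal a j)))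
    (i : Fin X.len) (hi : P.active (a i)) (h : reversal a (a i).succ = i.succ) :
    W.bwd (a i) ≫ P.map (a i) hi =
      eqToHom ((hW _).trans (congrArg (fun p => F.obj (X.reg p)) h)) ≫
        F.map (X.bwd i) ≫ F.map (toObj d hs i hi) := by
  subst hs
  have := congrArg F.map (d.comm_last i h =≫ P.proj hi)
  rw [lift_proj, F.map_preimage, Category.assoc, Category.assoc, F.map_comp,
    CategoryTheory.eqToHom_map, F.map_comp, ← toObj_rfl] at this
  rw [← cancel_epi (eqToHom (hr _).symm)]
  simpa using this

lemma bwd_toObj (hs : d.singMap = a) (i j : Fin X.len) (h : i.succ = j.castSucc) (hk : a i = a j)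
    (hj : P.active (a j)) :
    X.bwd i ≫ toObj d hs i (hk ▸ hj) ≫ eqToHom (congrArg P.obj hk) =
      eqToHom (congrArg X.reg h) ≫ X.fwd j ≫ toObj d hs j hj := by
  subst hs
  have := d.comm_mid i j h hk =≫ P.proj hj
  simpa [toObj_rfl, P.eqToHom_proj hk hj] using this

lemma fwd_map_eq_bwd_map (hs : d.singMap = a)
    (hW : ∀ j, W.reg j = F.obj (X.reg (reversal a j)))
    (k : Fin W.len) (hk : P.active k) (h : reversal a k.castSucc = reversal a k.succ) :
    W.fwd k ≫ P.map k hk =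
      eqToHom ((hW _).trans ((congrArg (fun p => F.obj (X.reg p)) h).trans (hW _).symm)) ≫
        W.bwd k ≫ P.map k hk := by
  subst hs
  have := congrArg F.map (d.comm_empty k h =≫ P.proj hk)
  rw [lift_proj, F.map_preimage, Category.assoc, lift_proj, F.map_comp,
    CategoryTheory.eqToHom_map, F.map_preimage] at this
  rw [← cancel_epi (eqToHom (hr _).symm)]
  simpa using this

lemma hom_ext_toObj {d' : Hom X (P.zigzag hr)} (hs : d.singMap = a) (hs' : d'.singMap = a)
    (h : ∀ i hi, toObj d hs i hi = toObj d' hs' i hi) : d = d' := by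
  refine Hom.ext' (fun i => DFunLike.congr_fun (hs.trans hs'.symm) i) fun i => ?_
  subst hs'
  refine P.hom_ext fun hk => ?_
  simpa [toObj] using h i hk

lemma toObj_congr {d d' : Hom X (P.zigzag hr)} (e : d = d') (hs : d.singMap = a)
    (hs' : d'.singMap = a) (i : Fin X.len) (h : P.active (a i)) :
    toObj d hs i h = toObj d' hs' i h := by
  subst e
  rfl

lemma toObj_comp (hs : d.singMap = a) {Y : ZigzagObj C} (f : Hom Y X)
    (hs' : (f.comp d).singMap = a.comp f.singMap)
    (i : Fin Y.len) (h : P.active (a (f.singMap i))) :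
    toObj (a := a.comp f.singMap) (f.comp d) hs' i h =
      f.app i ≫ toObj d hs (f.singMap i) h := by
  subst hs
  rw [toObj_rfl]
  exact (congrArg _ (Category.id_comp _)).trans (Category.assoc _ _ _)

end toObj

variable [F.Faithful]

/-- The map between the zigzags of two probes that is induced by a refinement. -/
noncomputable def refineHom {P P' : Probe F W} (t : Refines P P') :
    Hom (P.zigzag hr) (P'.zigzag hr) where
  singMap := OrderHom.id
  app k := P'.lift fun h => P.proj (t.active k h) ≫ t.hom k h
  reg_eq j := by simp
  comm_first k h := by
    have : P'.lift (fun h => F.preimage (eqToHom (hr _).symm ≫ W.fwd k ≫ P'.map k h)) =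
        eqToHom rfl ≫ P.lift (fun h => F.preimage (eqToHom (hr _).symm ≫ W.fwd k ≫ P.map k h)) ≫
          P'.lift fun h => P.proj (t.active k h) ≫ t.hom k h := by
      refine P'.hom_ext fun hk => F.map_injective ?_
      simp [← t.map_hom k hk, P.map_lift_proj_assoc]
    exact this
  comm_last k h := by
    have : P'.lift (fun h => F.preimage (eqToHom (hr _).symm ≫ W.bwd k ≫ P'.map k h)) =
        eqToHom rfl ≫ P.lift (fun h => F.preimage (eqToHom (hr _).symm ≫ W.bwd k ≫ P.map k h)) ≫
          P'.lift fun h => P.proj (t.active k h) ≫ t.hom k h := by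
      refine P'.hom_ext fun hk => F.map_injective ?_
      simp [← t.map_hom k hk, P.map_lift_proj_assoc]
    exact this
  comm_mid i j h hk := by
    obtain rfl : i = j := hk
    exact absurd h (by simp [Fin.ext_iff])
  comm_empty k h := by
    rw [reversal_id, reversal_id] at h
    exact absurd h (by simp [Fin.ext_iff])

/-- The composite of a zigzag map `w` from the image of `X` to `W` with the maps picked by a probe. -/
noncomputable def descend {X : ZigzagObj C} (w : Hom (mapObj F X) W)
    (hX : ∀ j, r j = X.reg (reversal w.heights j)) : Hom X (P.zigzag hr) where
  singMap := w.heights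
  app i := P.lift fun h => F.preimage (w.component i ≫ P.map _ h)
  reg_eq := hX
  comm_first i h := by
    refine P.hom_ext fun hk => F.map_injective ?_
    simp [CategoryTheory.eqToHom_map, w.fwd_heights i h]
  comm_last i h := by
    refine P.hom_ext fun hk => F.map_injective ?_
    simp [CategoryTheory.eqToHom_map, w.bwd_heights i h]
  comm_mid i j h hk := by
    refine P.hom_ext fun ha => F.map_injective ?_
    have := w.bwd_component i j h hk =≫ P.map _ ha
    simp only [Category.assoc, P.eqToHom_comp_map hk ha] at this
    simp only [Category.assoc, P.eqToHom_proj hk ha, lift_proj]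
    simp only [← Category.assoc (P.lift _), lift_proj]
    simpa [CategoryTheory.eqToHom_map] using this
  comm_empty k h := by
    refine P.hom_ext fun hk => F.map_injective ?_
    simp [CategoryTheory.eqToHom_map, w.fwd_eq_bwd k h]

section toObj

variable {P} {hr} {X : ZigzagObj C} {a : Fin X.len →o Fin W.len}

lemma map_toObj_descend (w : Hom (mapObj F X) W)
    (hX : ∀ j, r j = X.reg (reversal w.heights j)) (hs : (P.descend hr w hX).singMap = w.heights)
    (i : Fin X.len) (h : P.active (w.heights i)) :
    F.map (toObj (P.descend hr w hX) hs i h) = w.component i ≫ P.map _ h := by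
  have h1 : toObj (P.descend hr w hX) hs i h =
      P.lift (fun h => F.preimage (w.component i ≫ P.map _ h)) ≫ P.proj h :=
    congrArg (P.lift (fun h => F.preimage (w.component i ≫ P.map _ h)) ≫ ·) (Category.id_comp _)
  rw [h1, lift_proj, F.map_preimage]

lemma map_toObj_descend_of_eq (w : Hom (mapObj F X) W)
    (hX : ∀ j, r j = X.reg (reversal w.heights j)) (hs : (P.descend hr w hX).singMap = a)
    (hw : w.heights = a) (i : Fin X.len) (h : P.active (a i)) :
    F.map (toObj (P.descend hr w hX) hs i h) =
      w.component i ≫ eqToHom (congrArg W.sing (DFunLike.congr_fun hw i)) ≫ P.map _ h := by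
  subst hw
  rw [map_toObj_descend, eqToHom_refl, Category.id_comp]

lemma toObj_comp_refineHom (d : Hom X (P.zigzag hr)) (hs : d.singMap = a) {P' : Probe F W}
    (t : Refines P P')
    (hs' : (d.comp (refineHom hr t)).singMap = a)
    (i : Fin X.len) (h : P'.active (a i)) :
    toObj (d.comp (refineHom hr t)) hs' i h = toObj d hs i (t.active _ h) ≫ t.hom _ h := by
  subst hs
  rw [toObj_rfl]
  have h1 : toObj (d.comp (refineHom hr t)) hs' i h =
      (d.app i ≫ P'.lift fun h => P.proj (t.active _ h) ≫ t.hom _ h) ≫ P'.proj h :=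
    congrArg _ (Category.id_comp _)
  rw [h1]
  simp

end toObj

lemma comp_descend {X Y : ZigzagObj C} (f : Hom X Y) (w : Hom (mapObj F Y) W)
    (hY : ∀ j, r j = Y.reg (reversal w.heights j)) (w' : Hom (mapObj F X) W)
    (hw : (f.mapHom F).comp w = w')
    (hX : ∀ j, r j = X.reg (reversal w'.heights j)) :
    f.comp (P.descend hr w hY) = P.descend hr w' hX := by
  subst hw
  have hs : (f.comp (P.descend hr w hY)).singMap = w.heights.comp f.singMap := rfl
  refine hom_ext_toObj _ hs rfl fun i hi => F.map_injective ?_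
  refine Eq.trans ?_ (map_toObj_descend _ hX rfl i hi).symm
  have hs' : (P.descend hr w hY).singMap = w.heights := rfl
  have hi' : P.active (w.heights (f.singMap i)) := hi
  have h1 : F.map (f.app i ≫ toObj (P.descend hr w hY) hs' (f.singMap i) hi') =
      (F.map (f.app i) ≫ w.component (f.singMap i)) ≫ P.map _ hi' := by
    rw [F.map_comp, map_toObj_descend, Category.assoc]
  exact (congrArg F.map (toObj_comp _ hs' f hs i hi)).trans h1

lemma descend_comp_refineHom {X : ZigzagObj C} {P' : Probe F W} (t : Refines P P')
    (w : Hom (mapObj F X) W) (hX : ∀ j, r j = X.reg (reversal w.heights j)) :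
    (P.descend hr w hX).comp (refineHom hr t) = P'.descend hr w hX := by
  have hs : ((P.descend hr w hX).comp (refineHom hr t)).singMap = w.heights := rfl
  have hs' : (P.descend hr w hX).singMap = w.heights := rfl
  have hs_desc : (P'.descend hr w hX).singMap = w.heights := rfl
  refine hom_ext_toObj _ hs hs_desc fun i hi => F.map_injective ?_
  rw [toObj_comp_refineHom _ hs', F.map_comp, map_toObj_descend, map_toObj_descend, Category.assoc,
    t.map_hom]

end Probe

/-! ### Zigzag maps as compatible families -/

/-- A condition expressing that objects of `D` are limits of objects in the image of `F`: maps into `B`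
are separated by the maps from `B` to the objects `F x`, and a family of maps `c ⟶ x` indexed by the
maps `q : B ⟶ F x`, natural in `x`, comes from a map `F c ⟶ B`. For fully faithful
`F` this follows from codensity, which requires the existence of maps for all sources. -/
structure IsWeaklyCodense (F : C ⥤ D) : Prop where
  hom_ext : ∀ {A B : D} {f g : A ⟶ B}, (∀ (x : C) (q : B ⟶ F.obj x), f ≫ q = g ≫ q) → f = g
  exists_hom : ∀ (c : C) (B : D) (φ : ∀ x : C, (B ⟶ F.obj x) → (c ⟶ x)),
    (∀ (x y : C) (q : B ⟶ F.obj x) (f : x ⟶ y), φ y (q ≫ F.map f) = φ x q ≫ f) →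
      ∃ t : F.obj c ⟶ B, ∀ (x : C) (q : B ⟶ F.obj x), t ≫ q = F.map (φ x q)

/-- By the Yoneda lemma, a map from `B` to the representable of `x` is an element of `B.unop.obj x`. A
family of maps `c ⟶ x` as in `IsWeaklyCodense` is thus a natural transformation from `B.unop` to
`Hom(c, -)`. -/
lemma isWeaklyCodense_dualYoneda (C : Type u) [Category.{v} C] :
    IsWeaklyCodense (dualYoneda C) where
  hom_ext {A B f g} h := by
    apply Quiver.Hom.unop_inj
    ext x b
    have := congrArg Quiver.Hom.unop (h x (coyonedaEquiv.symm b).op)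
    have := congrArg coyonedaEquiv this
    simpa [coyonedaEquiv] using this
  exists_hom c B φ hφ := by
    refine ⟨Quiver.Hom.op
      { app x := ↾ fun b => φ x (coyonedaEquiv.symm b).op, naturality := ?_ }, ?_⟩
    · intro x y f
      ext b
      have h1 : (coyonedaEquiv.symm (B.unop.map f b)).op =
          (coyonedaEquiv.symm b).op ≫ (dualYoneda C).map f := by
        apply Quiver.Hom.unop_inj
        apply coyonedaEquiv.injective
        simp [coyonedaEquiv]
      have h2 := hφ x y (coyonedaEquiv.symm b).op f
      rw [← h1] at h2
      simpa using h2
    · intro x q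
      apply Quiver.Hom.unop_inj
      apply coyonedaEquiv.injective
      have h1 : (coyonedaEquiv.symm (coyonedaEquiv q.unop)).op = q := by simp
      have h2 : φ x (coyonedaEquiv.symm (coyonedaEquiv q.unop)).op = φ x q := by rw [h1]
      simpa [coyonedaEquiv] using h2

section

variable [HasTerminal C] [F.Full] [F.Faithful] {W : ZigzagObj D}
  {r : Fin (W.len + 1) → C} (hr : ∀ j, W.reg j = F.obj (r j)) {X : ZigzagObj C}

open Probe

/-- A zigzag map from the image of `X` to `W` is determined by its composites with probes: the probe
that picks nothing determines the map on heights, and the probes of a single height determine the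
morphisms on singular objects. -/
lemma hom_ext_descend (hF : IsWeaklyCodense F) {w w' : Hom (mapObj F X) W}
    (hw : ∀ j, r j = X.reg (reversal w.heights j))
    (hw' : ∀ j, r j = X.reg (reversal w'.heights j))
    (h : ∀ P : Probe F W, P.descend hr w hw = P.descend hr w' hw') : w = w' := by
  have hs : w.heights = w'.heights := by
    have h0 := congrArg Hom.singMap (h none)
    -- Both sides agree with those of the goal by definition of `descend`.
    exact h0
  have happ : ∀ i : Fin X.len,
      w.component i ≫ eqToHom (congrArg W.sing (DFunLike.congr_fun hs i)) = w'.component i := by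
    refine fun i => hF.hom_ext fun x q => ?_
    have hs₁ : ((single (w'.heights i) q).descend hr w hw).singMap = w'.heights := hs
    have hs₂ : ((single (w'.heights i) q).descend hr w' hw').singMap = w'.heights := rfl
    have h1 := congrArg F.map
      (toObj_congr (h (single (w'.heights i) q)) hs₁ hs₂ i (single_active q))
    rw [map_toObj_descend_of_eq w hw hs₁ hs i (single_active q), map_toObj_descend,
      single_map_self] at h1
    rwa [Category.assoc]
  exact Hom.ext' (DFunLike.congr_fun hs) happ

/-- A family of maps from `X` to the zigzags of all probes of `W` which is natural in the probe comes
from a zigzag map from the image of `X` to `W`. -/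
lemma exists_descend_eq (hF : IsWeaklyCodense F) (d : ∀ P : Probe F W, Hom X (P.zigzag hr))
    (hd : ∀ {P P' : Probe F W} (t : Refines P P'), (d P).comp (refineHom hr t) = d P') :
    ∃ (w : Hom (mapObj F X) W) (hw : ∀ j, r j = X.reg (reversal w.heights j)),
      ∀ P, P.descend hr w hw = d P := by
  -- All maps `d P` agree on heights with the one for the probe that picks nothing.
  obtain ⟨a, ha⟩ : ∃ a : Fin X.len →o Fin W.len, a = (d none).singMap := ⟨_, rfl⟩
  have hs : ∀ P, (d P).singMap = a := fun P => by
    rw [ha, ← hd (refinesNone P)]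
    rfl
  have hX : ∀ j, r j = X.reg (reversal a j) := by
    subst ha
    exact (d none).reg_eq
  have hW : ∀ j, W.reg j = F.obj (X.reg (reversal a j)) := fun j =>
    (hr j).trans (congrArg F.obj (hX j))
  -- The value of `d P` at a height is determined by the probes of that height alone.
  have hsingle : ∀ (P : Probe F W) (i : Fin X.len) (h : P.active (a i)) (x : C)
      (f : P.obj (a i) ⟶ x) (q : W.sing (a i) ⟶ F.obj x) (hq : P.map (a i) h ≫ F.map f = q),
      toObj (d (single (a i) q)) (hs _) i rfl = toObj (d P) (hs _) i h ≫ f := by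
    intro P i h x f q hq
    subst hq
    have hs' : ((d P).comp (refineHom hr (refinesSingle P (a i) h f))).singMap = a := hs P
    have h1 := toObj_comp_refineHom (d P) (hs P) (refinesSingle P (a i) h f) hs' i rfl
    exact (toObj_congr (hd (refinesSingle P (a i) h f)) hs' (hs _) i rfl).symm.trans
      (h1.trans (congrArg _ (Category.id_comp f)))
  -- The single-height probes at `a i` give a natural family of maps, hence the morphism at `i`.
  choose t ht using fun i => hF.exists_hom (X.sing i) (W.sing (a i))
    (fun x q => toObj (d (single (a i) q)) (hs _) i (single_active q))
    (fun x y q f => hsingle (single (a i) q) i rfl y f (q ≫ F.map f)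
      (congrArg (· ≫ F.map f) (Category.id_comp q)))
  have htP : ∀ (P : Probe F W) (i : Fin X.len) (h : P.active (a i)),
      t i ≫ P.map (a i) h = F.map (toObj (d P) (hs P) i h) := by
    intro P i h
    rw [ht i _ (P.map (a i) h), hsingle P i h _ (𝟙 _) _ (by simp), Category.comp_id]
  -- The faces commute since they do so after composition with every map to an object `F x`.
  have hfwd : ∀ (i : Fin X.len) (h : reversal a (a i).castSucc = i.castSucc),
      W.fwd (a i) = eqToHom ((hW _).trans (congrArg (fun p => F.obj (X.reg p)) h)) ≫
        F.map (X.fwd i) ≫ t i := by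
    refine fun i h => hF.hom_ext fun x q => ?_
    have := fwd_map (d (single (a i) q)) (hs _) hW i (single_active q) h
    rw [← htP, single_map_self] at this
    simpa using this
  have hbwd : ∀ (i : Fin X.len) (h : reversal a (a i).succ = i.succ),
      W.bwd (a i) = eqToHom ((hW _).trans (congrArg (fun p => F.obj (X.reg p)) h)) ≫
        F.map (X.bwd i) ≫ t i := by
    refine fun i h => hF.hom_ext fun x q => ?_
    have := bwd_map (d (single (a i) q)) (hs _) hW i (single_active q) h
    rw [← htP, single_map_self] at this
    simpa using this
  have hmid : ∀ (i j : Fin X.len) (h : i.succ = j.castSucc) (hk : a i = a j),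
      F.map (X.bwd i) ≫ t i ≫ eqToHom (congrArg W.sing hk) =
        eqToHom (congrArg (fun p => F.obj (X.reg p)) h) ≫ F.map (X.fwd j) ≫ t j := by
    refine fun i j h hk => hF.hom_ext fun x q => ?_
    have := congrArg F.map
      (bwd_toObj (d (single (a j) q)) (hs _) i j h hk (single_active q))
    rw [F.map_comp, F.map_comp, F.map_comp, F.map_comp, ← htP, ← htP,
      CategoryTheory.eqToHom_map, CategoryTheory.eqToHom_map, Category.assoc,
      ← eqToHom_comp_map (single (a j) q) hk (single_active q), single_map_self] at this
    simpa using this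
  have hempty : ∀ (k : Fin W.len) (h : reversal a k.castSucc = reversal a k.succ),
      W.fwd k = eqToHom ((hW _).trans
        ((congrArg (fun p => F.obj (X.reg p)) h).trans (hW _).symm)) ≫ W.bwd k := by
    refine fun k h => hF.hom_ext fun x q => ?_
    have := fwd_map_eq_bwd_map (d (single k q)) (hs _) hW k (single_active q) h
    rw [single_map_self] at this
    simpa using this
  let w : Hom (mapObj F X) W := ⟨a, t, hW, hfwd, hbwd, hmid, hempty⟩
  have hw : ∀ j, r j = X.reg (reversal w.heights j) := hX
  refine ⟨w, hw, fun P => ?_⟩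
  have hsw : (P.descend hr w hw).singMap = w.heights := rfl
  have hsd : (d P).singMap = w.heights := hs P
  refine hom_ext_toObj _ hsw hsd fun i hi => F.map_injective ?_
  exact (map_toObj_descend w hw hsw i hi).trans (htP P i hi)

end

section

variable [HasTerminal C] [F.Full] [F.Faithful] {J : Type w} [Category.{w'} J] [IsConnected J]

open Probe

/-- If `F` is fully faithful and weakly codense, then the zigzag functor of `F` preserves connected
colimits. -/
lemma preservesColimitsOfShape_zigzagFunctor (hF : IsWeaklyCodense F) :
    PreservesColimitsOfShape J (zigzagFunctor F) := by
  refine ⟨fun {K} => ⟨fun {c} hc => ?_⟩⟩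
  have key : ∀ s : Cocone (K ⋙ zigzagFunctor F),
      ∃! m : (zigzagFunctor F).obj c.pt ⟶ s.pt,
        ∀ j, (zigzagFunctor F).map (c.ι.app j) ≫ m = s.ι.app j := by
    intro s
    let W : ZigzagObj D := s.pt
    let w : ∀ j, Hom (mapObj F (K.obj j)) W := fun j => s.ι.app j
    have hw : ∀ {j j' : J} (f : j ⟶ j'), (Hom.mapHom F (K.map f)).comp (w j') = w j :=
      fun f => s.w f
    -- The regular objects of `W` come from objects of `C`, independent of `j` by connectedness.
    obtain ⟨r, hrK⟩ : ∃ r : Fin (W.len + 1) → C,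
        ∀ j k, r k = (K.obj j).reg (reversal (w j).heights k) := by
      refine ⟨fun k => (K.obj (Classical.arbitrary J)).reg (reversal (w _).heights k),
        fun j k => ?_⟩
      refine constant_of_preserves_morphisms
        (fun j => (K.obj j).reg (reversal (w j).heights k)) (fun j₁ j₂ f => ?_) _ _
      rw [← hw f]
      have h1 : ((Hom.mapHom F (K.map f)).comp (w j₂)).heights =
        (w j₂).heights.comp (K.map f).singMap := rfl
      rw [h1, reversal_comp, (K.map f).reg_eq]
    have hr : ∀ k, W.reg k = F.obj (r k) := fun k => by
      rw [hrK (Classical.arbitrary J), ← (w _).reg_eq_obj]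
    have hrc : ∀ (m : Hom (mapObj F c.pt) W),
        (∀ j, (Hom.mapHom F (c.ι.app j)).comp m = w j) →
          ∀ k, r k = c.pt.reg (reversal m.heights k) := by
      intro m hm k
      rw [hrK (Classical.arbitrary J), ← hm]
      have h1 : ((Hom.mapHom F (c.ι.app (Classical.arbitrary J))).comp m).heights =
        m.heights.comp (c.ι.app (Classical.arbitrary J)).singMap := rfl
      rw [h1, reversal_comp]
      exact ((c.ι.app _).reg_eq _).symm
    -- Each probe of `W` turns the given cocone into a cocone on `K`.
    let t (P : Probe F W) : Cocone K :=
      { pt := P.zigzag hr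
        ι :=
          { app j := P.descend hr (w j) (hrK j)
            naturality j j' f :=
              (P.comp_descend hr (K.map f) (w j') (hrK j') (w j) (hw f) (hrK j)).trans
                (Category.comp_id (X := K.obj j) (Y := P.zigzag hr)
                  (P.descend hr (w j) (hrK j))).symm } }
    obtain ⟨m, hmr, hm⟩ := exists_descend_eq hr hF (fun P => hc.desc (t P)) (fun {P P'} u => by
      refine hc.hom_ext (W := P'.zigzag hr) fun j => ?_
      rw [hc.fac (t P')]
      have h1 : (c.ι.app j ≫ hc.desc (t P)) = P.descend hr (w j) (hrK j) := hc.fac (t P) j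
      refine (Category.assoc (c.ι.app j) (hc.desc (t P)) (Z := P'.zigzag hr)
        (refineHom hr u)).symm.trans ?_
      rw [h1]
      exact descend_comp_refineHom P hr u (w j) (hrK j))
    refine ⟨m, fun j => ?_, fun m' hm' => ?_⟩
    · have hX : ∀ k,
          r k = (K.obj j).reg (reversal ((Hom.mapHom F (c.ι.app j)).comp m).heights k) := by
        intro k
        have h1 : ((Hom.mapHom F (c.ι.app j)).comp m).heights =
          m.heights.comp (c.ι.app j).singMap := rfl
        rw [h1, reversal_comp]
        exact (hmr k).trans ((c.ι.app j).reg_eq _)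
      refine hom_ext_descend hr hF hX (hrK j) fun P => ?_
      refine (P.comp_descend hr (c.ι.app j) m hmr _ rfl hX).symm.trans ?_
      rw [hm]
      exact hc.fac (t P) j
    · refine hom_ext_descend hr hF (hrc m' hm') hmr fun P => ?_
      rw [hm]
      refine hc.hom_ext (W := P.zigzag hr) fun j => ?_
      rw [hc.fac (t P)]
      exact P.comp_descend hr (c.ι.app j) m' _ _ (hm' j) (hrK j)
  choose m hm hu using key
  exact ⟨{ desc := m, fac := hm, uniq := hu }⟩

end

end ZigzagObj

theorem mainTheorem5 (C : Type u) [Category.{v} C] [HasTerminal C]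
    (J : Type w) [Category.{w'} J] [IsConnected J] :
    PreservesColimitsOfShape J (zigzagFunctor (dualYoneda C)) := by
  exact ZigzagObj.preservesColimitsOfShape_zigzagFunctor (ZigzagObj.isWeaklyCodense_dualYoneda C)
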